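/- **Proposition 3 (robustness to frequency perturbations).** Let $n\ge 2$ be an integer, $\omega>0$, and let $Q\colon[0,2\pi]\to\mathbb R$ be continuous with $z+Q(z)\in[0,2\pi]$ for all $z\in[0,2\pi]$. Let $C=[0,2\pi]^n$, $D=\{x\in C:\max_i x_i=2\pi\}$, and for $x\in D$ let $G(x)=g_1(x)\times\dots\times g_n(x)$, where $g_i(x)=\{0\}$ if $x_i=2\pi$ and $x_j\ne2\pi$ for all $j\neq i$; $g_i(x)=\{x_i+Q(x_i)\}$ if $x_i\neq 2\pi$ (so $x_j=2\pi$ for some $j\ne i$); and $g_i(x)=\{0,\,x_i+Q(x_i)\}$ if $x_i=2\pi$ and $x_j=2\pi$ for some $j\neq i$. Let $\mathcal H$ be the hybrid system $$\dot x=\omega\mathbf 1_n\quad (x\in C),\qquad x^+\in G(x)\quad (x\in D),$$ where $\mathbf 1_n=(1,\dots,1)\in\mathbb R^n$, and, for a function $d\colon\mathbb R_{\ge0}\to\mathbb R^n$, let $\mathcal H_d$ be the hybrid system with the same $C$, $D$, $G$ and the perturbed flow $\dot x=\omega\mathbf 1_n+d(t)$, $x\in C$. A solution is a hybrid arc (a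 function $\phi$ on a nonempty hybrid time domain $\operatorname{dom}\phi\subset\mathbb R_{\ge0}\times\mathbb N_0$, locally absolutely continuous in $t$ on each $I^j=\{t:(t,j)\in\operatorname{dom}\phi\}$), not necessarily maximal, with $\phi(0,0)\in\overline C\cup D$, such that, for each $j$ for which $I^j$ has nonempty interior, $\phi(t,j)\in C$ for all $t\in\operatorname{int}I^j$ and the flow equation holds for almost all $t\in I^j$, and such that $\phi(t,j)\in D$ and $\phi(t,j+1)\in G(\phi(t,j))$ whenever $(t,j),(t,j+1)\in\operatorname{dom}\phi$. Two hybrid arcs $\xi_1,\xi_2$ are $(\tau,\varepsilon)$-close if for all $(t,j)\in\operatorname{dom}\xi_1$ with $t+j\le\tau$ there is $s$ with $(s,j)\in\operatorname{dom}\xi_2$, $|t-s|<\varepsilon$ and $|\xi_1(t,j)-\xi_2(s,j)|<\varepsilon$, and the same holds with $\xi_1$ and $\xi_2$ exchanged. Here $|\cdot|$ is the Euclidean norm. Then for every $\varepsilon>0$ and $\tau\ge0$ there exists $\delta>0$ such that, for every Lebesgue measurable $d\colon\mathbb R_{\ge0}\to\mathbb R^n$ with $|d(t)|\le\delta$ for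 all $t\ge 0$ and every solution $\phi_d$ to $\mathcal H_d$ with $\phi_d(0,0)\in C$, there exists a solution $\phi$ to $\mathcal H$ with $\phi(0,0)\in C$ such that $\phi$ and $\phi_d$ are $(\tau,\varepsilon)$-close. -/

import Mathlib

open scoped NNReal

namespace PCO

/-- A compact hybrid time domain: a set `⋃_{j < J} [t_j, t_{j+1}] × {j}` for a finite sequence of
times `0 = t_0 ≤ t_1 ≤ ⋯ ≤ t_J` with `J ≥ 1`. -/
def IsCompactHybridTimeDomain (E : Set (ℝ × ℕ)) : Prop :=
  ∃ (J : ℕ) (t : ℕ → ℝ), 1 ≤ J ∧ t 0 = 0 ∧ (∀ j < J, t j ≤ t (j + 1)) ∧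
    E = {p | p.2 < J ∧ t p.2 ≤ p.1 ∧ p.1 ≤ t (p.2 + 1)}

/-- A hybrid time domain: a nonempty set whose truncations `E ∩ ([0, T] × {0, …, J})`,
`(T, J) ∈ E`, are compact hybrid time domains. (In particular `E ⊆ ℝ≥0 × ℕ₀`.) -/
def IsHybridTimeDomain (E : Set (ℝ × ℕ)) : Prop :=
  E.Nonempty ∧ ∀ p ∈ E, IsCompactHybridTimeDomain (E ∩ {q | 0 ≤ q.1 ∧ q.1 ≤ p.1 ∧ q.2 ≤ p.2})

/-- A hybrid arc: a function on a hybrid time domain such that `t ↦ φ(t, j)` is locally absolutely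
continuous on `I^j = {t | (t, j) ∈ dom φ}` for each `j`. The values of `val` off `dom` carry no
meaning. -/
structure HybridArc (X : Type*) [PseudoMetricSpace X] where
  /-- The domain of the arc. -/
  dom : Set (ℝ × ℕ)
  /-- The values of the arc. -/
  val : ℝ → ℕ → X
  isHybridTimeDomain_dom : IsHybridTimeDomain dom
  locallyAbsolutelyContinuous : ∀ (j : ℕ) (a b : ℝ), a ≤ b → (∀ t ∈ Set.Icc a b, (t, j) ∈ dom) →
    AbsolutelyContinuousOnInterval (fun t => val t j) a b

/-- The flow interval `I^j = {t | (t, j) ∈ dom φ}`. -/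
def HybridArc.interval {X : Type*} [PseudoMetricSpace X] (φ : HybridArc X) (j : ℕ) : Set ℝ :=
  {t | (t, j) ∈ φ.dom}

/-- `(τ, ε)`-closeness of two hybrid arcs. -/
def HybridArc.Close {X : Type*} [PseudoMetricSpace X] (τ ε : ℝ) (ξ₁ ξ₂ : HybridArc X) : Prop :=
  (∀ (t : ℝ) (j : ℕ), (t, j) ∈ ξ₁.dom → t + j ≤ τ →
    ∃ s : ℝ, (s, j) ∈ ξ₂.dom ∧ |t - s| < ε ∧ dist (ξ₁.val t j) (ξ₂.val s j) < ε) ∧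
  (∀ (t : ℝ) (j : ℕ), (t, j) ∈ ξ₂.dom → t + j ≤ τ →
    ∃ s : ℝ, (s, j) ∈ ξ₁.dom ∧ |t - s| < ε ∧ dist (ξ₂.val t j) (ξ₁.val s j) < ε)

/-- The data `(C, f, D, G)` of a hybrid system `ẋ = f(x)`, `x ∈ C`; `x⁺ ∈ G(x)`, `x ∈ D`. -/
structure HybridSystem (X : Type*) where
  /-- The flow set `C`. -/
  flowSet : Set X
  /-- The flow map `f`. -/
  flowMap : X → X
  /-- The jump set `D`. -/
  jumpSet : Set X
  /-- The jump map `G`. -/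
  jumpMap : X → Set X

/-- The data of a hybrid system with an input in its flow map:
`ẋ = f(x, u)`, `x ∈ C`; `x⁺ ∈ G(x)`, `x ∈ D`. -/
structure HybridInputSystem (X U : Type*) where
  /-- The flow set `C`. -/
  flowSet : Set X
  /-- The flow map `f`. -/
  flowMap : X → U → X
  /-- The jump set `D`. -/
  jumpSet : Set X
  /-- The jump map `G`. -/
  jumpMap : X → Set X

section Solutions

variable {X U : Type*} [NormedAddCommGroup X] [NormedSpace ℝ X]

/-- `φ` is a (not necessarily maximal) solution to the hybrid system `H`. -/
structure HybridSystem.IsSolution (H : HybridSystem X) (φ : HybridArc X) : Prop where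
  init : φ.val 0 0 ∈ closure H.flowSet ∪ H.jumpSet
  flow_mem : ∀ j : ℕ, ∀ t ∈ interior (φ.interval j), φ.val t j ∈ H.flowSet
  flow : ∀ j : ℕ, (interior (φ.interval j)).Nonempty →
    ∀ᵐ t : ℝ, t ∈ φ.interval j →
      HasDerivWithinAt (fun s => φ.val s j) (H.flowMap (φ.val t j)) (φ.interval j) t
  jump : ∀ (t : ℝ) (j : ℕ), (t, j) ∈ φ.dom → (t, j + 1) ∈ φ.dom →
    φ.val t j ∈ H.jumpSet ∧ φ.val t (j + 1) ∈ H.jumpMap (φ.val t j)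

/-- `(φ, u)` is a (not necessarily maximal) solution pair to the hybrid system with input `H`;
`u` is read on `dom φ` only. The first two conditions say that `u` is a hybrid input, i.e. that
each `u(·, j)` is Lebesgue measurable and locally essentially bounded on `I^j`. -/
structure HybridInputSystem.IsSolutionPair [NormedAddCommGroup U] [MeasurableSpace U]
    (H : HybridInputSystem X U) (φ : HybridArc X) (u : ℝ → ℕ → U) : Prop where
  input_measurable : ∀ j : ℕ,
    AEMeasurable (fun t => u t j) (MeasureTheory.volume.restrict (φ.interval j))
  input_bounded : ∀ (j : ℕ) (a b : ℝ), Set.Icc a b ⊆ φ.interval j →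
    ∃ M : ℝ, ∀ᵐ t : ℝ, t ∈ Set.Icc a b → ‖u t j‖ ≤ M
  init : φ.val 0 0 ∈ closure H.flowSet ∪ H.jumpSet
  flow_mem : ∀ j : ℕ, ∀ t ∈ interior (φ.interval j), φ.val t j ∈ H.flowSet
  flow : ∀ j : ℕ, (interior (φ.interval j)).Nonempty →
    ∀ᵐ t : ℝ, t ∈ φ.interval j →
      HasDerivWithinAt (fun s => φ.val s j) (H.flowMap (φ.val t j) (u t j)) (φ.interval j) t
  jump : ∀ (t : ℝ) (j : ℕ), (t, j) ∈ φ.dom → (t, j + 1) ∈ φ.dom →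
    φ.val t j ∈ H.jumpSet ∧ φ.val t (j + 1) ∈ H.jumpMap (φ.val t j)

end Solutions

/-- The state space `ℝⁿ` with the Euclidean norm. -/
abbrev State (n : ℕ) : Type := EuclideanSpace ℝ (Fin n)

/-- The vector `𝟏ₙ`. -/
def ones (n : ℕ) : State n := WithLp.toLp 2 fun _ => 1

/-- The flow set `C = [0, 2π]ⁿ`. -/
def C (n : ℕ) : Set (State n) := {x | ∀ i, x i ∈ Set.Icc 0 (2 * Real.pi)}

/-- The jump set `D = {x ∈ [0, 2π]ⁿ | max_i x_i = 2π}`. -/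
def D (n : ℕ) : Set (State n) :=
  {x | x ∈ C n ∧ IsGreatest (Set.range fun i => x i) (2 * Real.pi)}

/-- The set of values of the `i`-th component `g_i(x)` of the jump map. -/
def g (Q : ℝ → ℝ) {n : ℕ} (x : State n) (i : Fin n) : Set ℝ :=
  {v | (x i = 2 * Real.pi ∧ (∀ j, j ≠ i → x j ≠ 2 * Real.pi) ∧ v = 0) ∨
    (x i ≠ 2 * Real.pi ∧ (∃ j, j ≠ i ∧ x j = 2 * Real.pi) ∧ v = x i + Q (x i)) ∨
    (x i = 2 * Real.pi ∧ (∃ j, j ≠ i ∧ x j = 2 * Real.pi) ∧ (v = 0 ∨ v = x i + Q (x i)))}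

/-- The jump map `G(x) = g_1(x) × ⋯ × g_n(x)`. -/
def G (Q : ℝ → ℝ) {n : ℕ} (x : State n) : Set (State n) := {y | ∀ i, y i ∈ g Q x i}

/-- The nominal network of pulse-coupled oscillators, with natural frequency `ω`. -/
noncomputable def nominal (n : ℕ) (ω : ℝ) (Q : ℝ → ℝ) : HybridSystem (State n) where
  flowSet := C n
  flowMap := fun _ => ω • ones n
  jumpSet := D n
  jumpMap := G Q

/-- The network with a frequency perturbation, which enters as an input: `ẋ = ω𝟏ₙ + d`. -/
noncomputable def perturbed (n : ℕ) (ω : ℝ) (Q : ℝ → ℝ) : HybridInputSystem (State n) (State n) where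
  flowSet := C n
  flowMap := fun _ d => ω • ones n + d
  jumpSet := D n
  jumpMap := G Q

/-- `φ` is a solution to `H_d` for the perturbation signal `d : ℝ≥0 → ℝⁿ`: the pair `(φ, d')` with
`d'(t, j) = d(t)` on `dom φ` (where `t ≥ 0`) is a solution pair. -/
def IsPerturbedSolution (n : ℕ) (ω : ℝ) (Q : ℝ → ℝ) (d : ℝ≥0 → State n)
    (φ : HybridArc (State n)) : Prop :=
  (perturbed n ω Q).IsSolutionPair φ fun t _ => d t.toNNReal

end PCO

namespace PCO

open Set Filter Topology MeasureTheory

/-! The proof is by compactness. Up to hybrid time `τ`, a perturbed solution is recorded by a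
sequence, its trace (`IsTrace`): the start times of its flow intervals and the states at their ends.
Since `‖d‖ ≤ δ`, each flow piece misses the nominal displacement by at most `κ = δ * τ`.

All conditions on a trace are closed, because `G` has closed graph over the closed set `D`, and they
confine it to a product of compact sets. The sets of `κ`-traces shrink to the set of exact traces as
`κ → 0`, so for small `κ` every `κ`-trace is uniformly near an exact one
(`eventually_exists_isTrace_dist_lt`). Interpolating an exact trace affinely gives a nominal
solution (`IsTrace.isSolution_arc`), because `C` is convex; an affine estimate then yields
closeness. -/

/-! ### Mean value inequality for absolutely continuous curves. -/

theorem _root_.LipschitzWith.comp_absolutelyContinuousOnInterval {X Y : Type*}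
    [PseudoMetricSpace X] [PseudoMetricSpace Y] {K : ℝ≥0} {g : X → Y} (hg : LipschitzWith K g)
    {f : ℝ → X} {a b : ℝ} (hf : AbsolutelyContinuousOnInterval f a b) :
    AbsolutelyContinuousOnInterval (fun t => g (f t)) a b := by
  rw [absolutelyContinuousOnInterval_iff] at hf ⊢
  intro ε hε
  obtain ⟨δ, hδ, h⟩ := hf (ε / (K + 1)) (by positivity)
  refine ⟨δ, hδ, fun E hE hlen => ?_⟩
  have h1 := h E hE hlen
  rw [lt_div_iff₀ (by positivity)] at h1
  calc _ ≤ ∑ i ∈ Finset.range E.1, K * dist (f (E.2 i).1) (f (E.2 i).2) :=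
        Finset.sum_le_sum fun i _ => hg.dist_le_mul _ _
    _ = K * ∑ i ∈ Finset.range E.1, dist (f (E.2 i).1) (f (E.2 i).2) := by
        rw [Finset.mul_sum]
    _ ≤ (∑ i ∈ Finset.range E.1, dist (f (E.2 i).1) (f (E.2 i).2)) * (K + 1) := by
        rw [mul_comm]
        gcongr
        simp
    _ < ε := h1

/-- Pairing with `w = f b - f a` reduces to the scalar fundamental theorem of calculus, which gives
`‖w‖ ^ 2 ≤ ‖w‖ * c * (b - a)`. -/
theorem _root_.AbsolutelyContinuousOnInterval.norm_sub_le {E : Type*} [NormedAddCommGroup E]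
    [InnerProductSpace ℝ E] {f : ℝ → E} {a b c : ℝ} (hab : a ≤ b)
    (hf : AbsolutelyContinuousOnInterval f a b)
    (hderiv : ∀ᵐ t : ℝ, t ∈ Ioo a b → ∃ v : E, HasDerivAt f v t ∧ ‖v‖ ≤ c) :
    ‖f b - f a‖ ≤ c * (b - a) := by
  set w := f b - f a with hw
  have hac : AbsolutelyContinuousOnInterval (fun t => innerSL ℝ w (f t)) a b :=
    (innerSL ℝ w).lipschitz.comp_absolutelyContinuousOnInterval hf
  have hint := hac.integral_deriv_eq_sub
  have hbound : ‖∫ t in a..b, deriv (fun t => innerSL ℝ w (f t)) t‖ ≤ ‖w‖ * c * |b - a| := by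
    apply intervalIntegral.norm_integral_le_of_norm_le_const_ae
    filter_upwards [hderiv, Measure.ae_ne volume b] with t ht htb htm
    rw [uIoc_of_le hab] at htm
    obtain ⟨v, hv, hvc⟩ := ht ⟨htm.1, lt_of_le_of_ne htm.2 htb⟩
    have h1 : HasDerivAt (fun t => innerSL ℝ w (f t)) (innerSL ℝ w v) t :=
      (innerSL ℝ w).hasFDerivAt.comp_hasDerivAt t hv
    rw [h1.deriv]
    calc ‖innerSL ℝ w v‖ ≤ ‖w‖ * ‖v‖ := norm_inner_le_norm w v
      _ ≤ ‖w‖ * c := by gcongr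
  rw [hint, ← map_sub, ← hw, innerSL_apply_apply, real_inner_self_eq_norm_sq,
    abs_of_nonneg (by linarith), Real.norm_of_nonneg (by positivity), mul_assoc, sq] at hbound
  rcases (norm_nonneg w).eq_or_lt with h0 | h0
  -- If `w = 0` nothing can be cancelled; `0 ≤ c` comes from a point where the derivative bound
  -- holds.
  · rw [← h0]
    by_cases h : a < b
    · have hne : ∃ t ∈ Ioo a b, ∃ v : E, HasDerivAt f v t ∧ ‖v‖ ≤ c := by
        by_contra! hcon
        have hz : volume (Ioo a b) = 0 := by
          refine measure_mono_null (fun t ht => ?_) hderiv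
          simp only [mem_compl_iff, mem_ofPred_eq, not_forall, not_exists, not_and]
          exact ⟨ht, fun v hv => not_le.2 (hcon t ht v hv)⟩
        rw [Real.volume_Ioo, ENNReal.ofReal_eq_zero] at hz
        linarith
      obtain ⟨t, _, v, _, hv⟩ := hne
      exact mul_nonneg ((norm_nonneg v).trans hv) (by linarith)
    · have : b - a = 0 := by linarith
      simp [this]
  · exact le_of_mul_le_mul_left hbound h0

/-! ### Topology of the flow set, the jump set and the jump map. -/

theorem mem_D_iff {n : ℕ} {x : State n} : x ∈ D n ↔ x ∈ C n ∧ ∃ i, x i = 2 * Real.pi := by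
  refine and_congr_right fun hx => ⟨fun h => h.1, fun h => ⟨h, ?_⟩⟩
  rintro _ ⟨i, rfl⟩
  exact (hx i).2

theorem isClosed_C (n : ℕ) : IsClosed (C n) := by
  simp only [C, ofPred_forall]
  exact isClosed_iInter fun i => isClosed_Icc.preimage (by fun_prop)

theorem isCompact_C (n : ℕ) : IsCompact (C n) := by
  have : C n = (EuclideanSpace.equiv (Fin n) ℝ).toHomeomorph ⁻¹'
      (Set.univ.pi fun _ => Icc 0 (2 * Real.pi)) := by
    ext x
    exact (Set.mem_univ_pi (t := fun _ => Icc 0 (2 * Real.pi))).symm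
  rw [this]
  exact (Homeomorph.isCompact_preimage _).2 (isCompact_univ_pi fun _ => isCompact_Icc)

theorem isClosed_D (n : ℕ) : IsClosed (D n) := by
  have : D n = C n ∩ ⋃ i, {x : State n | x i = 2 * Real.pi} := by
    ext x
    simp [mem_D_iff]
  rw [this]
  exact (isClosed_C n).inter
    (isClosed_iUnion_of_finite fun i => isClosed_eq (by fun_prop) continuous_const)

/-- On `D` the inequations in `g` are redundant; without them the condition is visibly closed. -/
theorem mem_g_iff {Q : ℝ → ℝ} {n : ℕ} {x : State n} (hx : x ∈ D n) {i : Fin n} {v : ℝ} :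
    v ∈ g Q x i ↔ (x i = 2 * Real.pi ∧ v = 0) ∨
      ((∃ j, j ≠ i ∧ x j = 2 * Real.pi) ∧ v = x i + Q (x i)) := by
  obtain ⟨k, hk⟩ := (mem_D_iff.1 hx).2
  simp only [g, mem_ofPred_eq]
  by_cases h1 : x i = 2 * Real.pi <;> by_cases h2 : ∃ j, j ≠ i ∧ x j = 2 * Real.pi
  · simp [h1, h2]
  · simp only [h1, h2, true_and, false_and, or_false, not_true, ne_eq]
    push Not at h2
    simp only [and_iff_right_iff_imp]
    exact fun _ => h2
  · simp [h1, h2]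
  · exact absurd ⟨k, fun h => h1 (h ▸ hk), hk⟩ h2

theorem G_subset_C {Q : ℝ → ℝ} {n : ℕ}
    (hQ : ∀ z ∈ Icc 0 (2 * Real.pi), z + Q z ∈ Icc 0 (2 * Real.pi)) {x : State n}
    (hx : x ∈ D n) : G Q x ⊆ C n := by
  intro y hy i
  rcases (mem_g_iff hx).1 (hy i) with h | h
  · rw [h.2]
    exact ⟨le_rfl, Real.two_pi_pos.le⟩
  · rw [h.2]
    exact hQ _ (hx.1 i)

theorem isClosed_graph_G {Q : ℝ → ℝ} (n : ℕ) (hQ : ContinuousOn Q (Icc 0 (2 * Real.pi))) :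
    IsClosed {p : State n × State n | p.1 ∈ D n ∧ p.2 ∈ G Q p.1} := by
  have hpi : (0 : ℝ) ≤ 2 * Real.pi := Real.two_pi_pos.le
  set q : ℝ → ℝ := IccExtend hpi ((Icc 0 (2 * Real.pi)).domRestrict Q)
  have hq : Continuous q := (continuousOn_iff_continuous_domRestrict.1 hQ).Icc_extend'
  have hqQ : ∀ z ∈ Icc 0 (2 * Real.pi), q z = Q z := fun z hz => by
    simp only [q, IccExtend_of_mem hpi _ hz, domRestrict_apply]
  have : {p : State n × State n | p.1 ∈ D n ∧ p.2 ∈ G Q p.1} = {p | p.1 ∈ D n} ∩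
      ⋂ i, ({p | p.1 i = 2 * Real.pi} ∩ {p | p.2 i = 0}) ∪
        ((⋃ j, ⋃ (_ : j ≠ i), {p | p.1 j = 2 * Real.pi}) ∩ {p | p.2 i = p.1 i + q (p.1 i)}) := by
    ext p
    simp only [mem_inter_iff, mem_ofPred_eq, mem_iInter, mem_union, mem_iUnion, exists_prop]
    refine and_congr_right fun hp => forall_congr' fun i => ?_
    rw [mem_g_iff hp, hqQ _ (hp.1 i)]
  rw [this]
  refine ((isClosed_D n).preimage continuous_fst).inter (isClosed_iInter fun i => ?_)
  have hfst : ∀ j, Continuous fun p : State n × State n => p.1 j := fun j => by fun_prop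
  have hsnd : ∀ j, Continuous fun p : State n × State n => p.2 j := fun j => by fun_prop
  refine IsClosed.union (IsClosed.inter ?_ ?_) (IsClosed.inter ?_ ?_)
  · exact isClosed_eq (hfst i) continuous_const
  · exact isClosed_eq (hsnd i) continuous_const
  · exact isClosed_iUnion_of_finite fun j => isClosed_iUnion_of_finite fun _ =>
      isClosed_eq (hfst j) continuous_const
  · exact isClosed_eq (hsnd i) ((hfst i).add (hq.comp (hfst i)))

/-! ### Flow of perturbed solutions. -/

theorem HybridArc.continuousOn {X : Type*} [SeminormedAddCommGroup X] (φ : HybridArc X) {j : ℕ}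
    {a b : ℝ} (hab : a ≤ b) (h : Icc a b ⊆ φ.interval j) :
    ContinuousOn (fun t => φ.val t j) (Icc a b) := by
  have := AbsolutelyContinuousOnInterval.continuousOn
    (φ.locallyAbsolutelyContinuous j a b hab fun t ht => h ht)
  rwa [uIcc_of_le hab] at this

theorem HybridArc.Ioo_subset_interior {X : Type*} [PseudoMetricSpace X] (φ : HybridArc X) {j : ℕ}
    {a b : ℝ} (h : Icc a b ⊆ φ.interval j) : Ioo a b ⊆ interior (φ.interval j) :=
  interior_maximal (Ioo_subset_Icc_self.trans h) isOpen_Ioo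

section Perturbed

variable {n : ℕ} {ω : ℝ} {Q : ℝ → ℝ} {d : ℝ≥0 → State n} {φ : HybridArc (State n)} {δ : ℝ}

/-- After subtracting the nominal motion, the derivative is `d`, of norm at most `δ`. -/
theorem IsPerturbedSolution.norm_flow_sub_le (hφ : IsPerturbedSolution n ω Q d φ)
    (hd : ∀ t, ‖d t‖ ≤ δ) {j : ℕ} {a b : ℝ} (hab : a ≤ b) (h : Icc a b ⊆ φ.interval j) :
    ‖φ.val b j - φ.val a j - (ω * (b - a)) • ones n‖ ≤ δ * (b - a) := by
  rcases hab.eq_or_lt with rfl | hlt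
  · simp
  have hac := φ.locallyAbsolutelyContinuous j a b hab h
  have hlin : AbsolutelyContinuousOnInterval (fun t : ℝ => t • (ω • ones n)) a b :=
    ((ContinuousLinearMap.toSpanSingleton ℝ (ω • ones n)).lipschitz.lipschitzOnWith
      (s := uIcc a b)).absolutelyContinuousOnInterval
  have hint : (interior (φ.interval j)).Nonempty :=
    (nonempty_Ioo.2 hlt).mono (φ.Ioo_subset_interior h)
  have key := (hac.fun_sub hlin).norm_sub_le (c := δ) hab (by
    filter_upwards [hφ.flow j hint] with t ht htm
    have hmem : t ∈ interior (φ.interval j) := φ.Ioo_subset_interior h htm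
    have h1 := (ht (interior_subset hmem)).hasDerivAt (mem_interior_iff_mem_nhds.1 hmem)
    have h2 : HasDerivAt (fun t : ℝ => t • (ω • ones n)) ((1 : ℝ) • (ω • ones n)) t :=
      (hasDerivAt_id t).smul_const _
    refine ⟨_, h1.sub h2, ?_⟩
    simpa [perturbed] using hd t.toNNReal)
  have heq : φ.val b j - φ.val a j - (ω * (b - a)) • ones n =
      φ.val b j - b • (ω • ones n) - (φ.val a j - a • (ω • ones n)) := by module
  rwa [heq]

theorem IsPerturbedSolution.mem_C_of_lt (hφ : IsPerturbedSolution n ω Q d φ) {j : ℕ} {a b t : ℝ}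
    (hab : a < b) (h : Icc a b ⊆ φ.interval j) (ht : t ∈ Icc a b) : φ.val t j ∈ C n := by
  have hc := φ.continuousOn hab.le h
  have hmaps : MapsTo (fun t => φ.val t j) (Ioo a b) (C n) := fun s hs =>
    hφ.flow_mem j s (φ.Ioo_subset_interior h hs)
  rw [← closure_Ioo hab.ne] at ht hc
  exact (isClosed_C n).closure_subset (hmaps.closure_of_continuousOn hc ht)

/-- A perturbation smaller than `ω` does not allow flow out of the jump set. -/
theorem IsPerturbedSolution.not_mem_D (hφ : IsPerturbedSolution n ω Q d φ)
    (hd : ∀ t, ‖d t‖ ≤ δ) (hδ : δ < ω) {j : ℕ} {a b : ℝ} (hab : a < b)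
    (h : Icc a b ⊆ φ.interval j) : φ.val a j ∉ D n := by
  intro hD
  obtain ⟨i, hi⟩ := (mem_D_iff.1 hD).2
  have h1 := hφ.norm_flow_sub_le hd hab.le h
  have h2 := (hφ.mem_C_of_lt hab h (right_mem_Icc.2 hab.le) i).2
  have h3 := (PiLp.norm_apply_le (φ.val b j - φ.val a j - (ω * (b - a)) • ones n) i).trans h1
  simp only [PiLp.sub_apply, PiLp.smul_apply, ones, hi, smul_eq_mul, mul_one,
    Real.norm_eq_abs] at h3
  have h4 := (abs_le.1 h3).1
  have : 0 < (ω - δ) * (b - a) := mul_pos (by linarith) (by linarith)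
  linarith

end Perturbed

/-! ### Compactness of the set of traces. -/

/-- The finite-dimensional trace of a solution with `J` jumps on the time window `[0, τ]`, with
tolerance `κ` in the flow: `p j` consists of the time at which the `j`-th flow interval begins and
of the states at its beginning and at its end. The entries past `J + 1` are irrelevant. -/
structure IsTrace {n : ℕ} (ω : ℝ) (Q : ℝ → ℝ) (τ : ℝ) (J : ℕ) (κ : ℝ)
    (p : ℕ → ℝ × State n × State n) : Prop where
  mem : ∀ j, p j ∈ Icc 0 τ ×ˢ C n ×ˢ C n
  zero : (p 0).1 = 0
  mono : Monotone fun j => (p j).1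
  flow : ∀ j ≤ J, ‖(p j).2.2 - (p j).2.1 - (ω * ((p (j + 1)).1 - (p j).1)) • ones n‖ ≤ κ
  jump : ∀ j < J, (p j).2.2 ∈ D n ∧ (p (j + 1)).2.1 ∈ G Q (p j).2.2

section Trace

variable {n : ℕ} {ω : ℝ} {Q : ℝ → ℝ} {τ : ℝ} {J : ℕ}

theorem isClosed_setOf_isTrace (hQ : ContinuousOn Q (Icc 0 (2 * Real.pi))) (κ : ℝ) :
    IsClosed {p : ℕ → ℝ × State n × State n | IsTrace ω Q τ J κ p} := by
  have heq : {p : ℕ → ℝ × State n × State n | IsTrace ω Q τ J κ p} =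
      (⋂ j, {p | p j ∈ Icc 0 τ ×ˢ C n ×ˢ C n}) ∩ {p | (p 0).1 = 0} ∩
      (⋂ j, {p | (p j).1 ≤ (p (j + 1)).1}) ∩
      (⋂ j, ⋂ (_ : j ≤ J), {p | ‖(p j).2.2 - (p j).2.1 -
        (ω * ((p (j + 1)).1 - (p j).1)) • ones n‖ ≤ κ}) ∩
      (⋂ j, ⋂ (_ : j < J), (fun p => ((p j).2.2, (p (j + 1)).2.1)) ⁻¹'
        {p : State n × State n | p.1 ∈ D n ∧ p.2 ∈ G Q p.1}) := by
    ext p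
    simp only [mem_inter_iff, mem_iInter, mem_ofPred_eq, mem_preimage]
    exact ⟨fun h => ⟨⟨⟨⟨h.mem, h.zero⟩, fun j => h.mono j.le_succ⟩, h.flow⟩, h.jump⟩,
      fun h => ⟨h.1.1.1.1, h.1.1.1.2, monotone_nat_of_le_succ h.1.1.2, h.1.2, h.2⟩⟩
  rw [heq]
  refine ((((isClosed_iInter fun j => ?_).inter ?_).inter (isClosed_iInter fun j => ?_)).inter
    (isClosed_iInter fun j => isClosed_iInter fun _ => ?_)).inter
    (isClosed_iInter fun j => isClosed_iInter fun _ => ?_)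
  · exact (isClosed_Icc.prod ((isClosed_C n).prod (isClosed_C n))).preimage (continuous_apply j)
  · exact isClosed_eq (by fun_prop) continuous_const
  · exact isClosed_le (by fun_prop) (by fun_prop)
  · exact isClosed_le (by fun_prop) continuous_const
  · exact (isClosed_graph_G n hQ).preimage (by fun_prop)

theorem isCompact_setOf_isTrace (hQ : ContinuousOn Q (Icc 0 (2 * Real.pi))) (κ : ℝ) :
    IsCompact {p : ℕ → ℝ × State n × State n | IsTrace ω Q τ J κ p} :=
  (isCompact_univ_pi fun _ =>
    isCompact_Icc.prod ((isCompact_C n).prod (isCompact_C n))).of_isClosed_subset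
    (isClosed_setOf_isTrace hQ κ) fun _ hp j _ => hp.mem j

theorem eventually_exists_isTrace_dist_lt (hQ : ContinuousOn Q (Icc 0 (2 * Real.pi))) {η : ℝ}
    (hη : 0 < η) : ∀ᶠ κ in 𝓝[>] (0 : ℝ), ∀ p : ℕ → ℝ × State n × State n, IsTrace ω Q τ J κ p →
      ∃ q, IsTrace ω Q τ J 0 q ∧ ∀ j ≤ J + 1, dist (p j) (q j) < η := by
  have hmono : ∀ {κ κ' : ℝ}, κ ≤ κ' → ∀ p : ℕ → ℝ × State n × State n,
      IsTrace ω Q τ J κ p → IsTrace ω Q τ J κ' p := fun h p hp =>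
    ⟨hp.mem, hp.zero, hp.mono, fun j hj => (hp.flow j hj).trans h, hp.jump⟩
  let V : {κ : ℝ // 0 < κ} → Set (ℕ → ℝ × State n × State n) := fun κ => {p | IsTrace ω Q τ J κ p}
  have : Nonempty {κ : ℝ // 0 < κ} := ⟨⟨1, one_pos⟩⟩
  have hV : Directed (· ⊇ ·) V := fun a b =>
    ⟨⟨min a b, lt_min a.2 b.2⟩, fun p hp => hmono (min_le_left _ _) p hp,
      fun p hp => hmono (min_le_right _ _) p hp⟩
  let U : Set (ℕ → ℝ × State n × State n) :=
    {p | ∃ q, IsTrace ω Q τ J 0 q ∧ ∀ j ≤ J + 1, dist (p j) (q j) < η}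
  have hU : ∀ p ∈ ⋂ κ, V κ, U ∈ 𝓝 p := by
    intro p hp
    -- A point of the intersection is itself an exact trace, so it serves as `q` for all its
    -- neighbours.
    rw [mem_iInter] at hp
    have h0 : IsTrace ω Q τ J 0 p := by
      have h1 := hp ⟨1, one_pos⟩
      refine ⟨h1.mem, h1.zero, h1.mono, fun j hj => ?_, h1.jump⟩
      exact le_of_forall_pos_le_add fun κ hκ => by
        rw [zero_add]
        exact (hp ⟨κ, hκ⟩).flow j hj
    have hnear : ∀ᶠ p' : ℕ → ℝ × State n × State n in 𝓝 p, ∀ j ∈ Iic (J + 1),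
        dist (p' j) (p j) < η :=
      (eventually_all_finite (finite_Iic (J + 1))).2 fun j _ =>
        (continuous_apply j).continuousAt.eventually (Metric.ball_mem_nhds (p j) hη)
    exact hnear.mono fun p' hp' => ⟨p, h0, hp'⟩
  obtain ⟨⟨κ, hκ⟩, hsub⟩ := exists_subset_nhds_of_isCompact' hV
    (fun i => isCompact_setOf_isTrace hQ i) (fun i => isClosed_setOf_isTrace hQ i) hU
  filter_upwards [Ioc_mem_nhdsGT hκ] with κ' hκ' p hp
  exact hsub (hmono hκ'.2 p hp)

end Trace

/-! ### Structure of hybrid time domains. -/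

section TimeDomain

variable {E : Set (ℝ × ℕ)}

theorem IsHybridTimeDomain.exists_jump_times (hE : IsHybridTimeDomain E) {S : ℝ} {J : ℕ}
    (h : (S, J) ∈ E) : ∃ T : ℕ → ℝ, T 0 = 0 ∧ Monotone T ∧ (∀ j, T j ≤ S) ∧ T (J + 1) = S ∧
      ∀ t j, j ≤ J → ((T j ≤ t ∧ t ≤ T (j + 1)) ↔ (t, j) ∈ E ∧ 0 ≤ t ∧ t ≤ S) := by
  obtain ⟨K, T, hK, hT0, hT, heq⟩ := hE.2 _ h
  have hmem : ∀ t j, (j < K ∧ T j ≤ t ∧ t ≤ T (j + 1)) ↔ (t, j) ∈ E ∧ 0 ≤ t ∧ t ≤ S ∧ j ≤ J := by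
    intro t j
    exact (Set.ext_iff.1 heq (t, j)).symm
  have hTmono : ∀ k ≤ K, ∀ j ≤ k, T j ≤ T k := by
    intro k
    induction k with
    | zero => intro _ j hj; rw [Nat.le_zero.1 hj]
    | succ k ih =>
      intro hk j hj
      rcases hj.eq_or_lt with rfl | hlt
      · rfl
      · exact (ih (by omega) j (by omega)).trans (hT k (by omega))
  have hlast : 0 ≤ T K ∧ T K ≤ S ∧ K - 1 ≤ J := by
    have := (hmem (T K) (K - 1)).1 ⟨by omega, hTmono K le_rfl _ (by omega), by
      rw [Nat.sub_add_cancel hK]⟩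
    exact this.2
  have hS : 0 ≤ S := hlast.1.trans hlast.2.1
  have hJ := (hmem S J).2 ⟨h, hS, le_rfl, le_rfl⟩
  obtain rfl : K = J + 1 := by omega
  have hTS : T (J + 1) = S := le_antisymm hlast.2.1 hJ.2.2
  refine ⟨fun j => T (min j (J + 1)), by simpa using hT0, fun a b hab =>
    hTmono _ (min_le_right _ _) _ (min_le_min_right _ hab), fun j => ?_, by simpa using hTS,
    fun t j hj => ?_⟩
  · rw [← hTS]
    exact hTmono _ le_rfl _ (min_le_right _ _)
  · have := hmem t j
    simp only [min_eq_left (show j ≤ J + 1 by omega), min_eq_left (show j + 1 ≤ J + 1 by omega)]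
    simpa only [hj, show j < J + 1 by omega, true_and, and_true] using this

theorem IsHybridTimeDomain.zero_mem (hE : IsHybridTimeDomain E) : ((0 : ℝ), 0) ∈ E := by
  obtain ⟨⟨S, J⟩, hp⟩ := hE.1
  obtain ⟨T, h0, hmono, -, -, hT⟩ := hE.exists_jump_times hp
  exact ((hT 0 0 (Nat.zero_le _)).1 ⟨h0.le, h0 ▸ hmono zero_le_one⟩).1

theorem IsHybridTimeDomain.nonneg (hE : IsHybridTimeDomain E) {t : ℝ} {j : ℕ} (h : (t, j) ∈ E) :
    0 ≤ t := by
  obtain ⟨T, h0, -, hS, -, -⟩ := hE.exists_jump_times h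
  exact h0 ▸ hS 0

theorem IsHybridTimeDomain.Icc_subset (hE : IsHybridTimeDomain E) {a b : ℝ} {j : ℕ}
    (ha : (a, j) ∈ E) (hb : (b, j) ∈ E) : Icc a b ⊆ {t | (t, j) ∈ E} := by
  intro t ht
  obtain ⟨T, -, -, -, hS, hT⟩ := hE.exists_jump_times hb
  have h1 := (hT a j le_rfl).2 ⟨ha, hE.nonneg ha, ht.1.trans ht.2⟩
  exact ((hT t j le_rfl).1 ⟨h1.1.trans ht.1, hS ▸ ht.2⟩).1

/-- The last flow interval may be open on the right, so its supremum is only approached, up to `η`.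
-/
theorem IsHybridTimeDomain.exists_last (hE : IsHybridTimeDomain E) {τ η : ℝ} (hτ : 0 ≤ τ)
    (hη : 0 < η) : ∃ S J, (S, J) ∈ E ∧ S + J ≤ τ ∧
      ∀ t j, (t, j) ∈ E → t + j ≤ τ → j ≤ J ∧ (j = J → t ≤ S + η) := by
  set A : Set ℕ := {j | ∃ t : ℝ, (t, j) ∈ E ∧ t + j ≤ τ}
  have hne : A.Nonempty := ⟨0, 0, hE.zero_mem, by simpa using hτ⟩
  have hbdd : BddAbove A := ⟨⌊τ⌋₊, by
    rintro j ⟨t, ht, hle⟩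
    exact Nat.le_floor (by linarith [hE.nonneg ht])⟩
  have hJ := Nat.sSup_mem hne hbdd
  set J := sSup A
  set B : Set ℝ := {t | (t, J) ∈ E ∧ t + J ≤ τ}
  have hBne : B.Nonempty := hJ
  have hBbdd : BddAbove B := ⟨τ - J, fun t ht => by linarith [ht.2]⟩
  obtain ⟨S, hS, hlt⟩ := exists_lt_of_lt_csSup hBne (sub_lt_self (sSup B) hη)
  refine ⟨S, J, hS.1, hS.2, fun t j ht hle => ⟨le_csSup hbdd ⟨t, ht, hle⟩, ?_⟩⟩
  rintro rfl
  linarith [le_csSup hBbdd ⟨ht, hle⟩]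

end TimeDomain

/-! ### From perturbed solutions to traces. -/

section Perturbed

variable {n : ℕ} {ω : ℝ} {Q : ℝ → ℝ} {d : ℝ≥0 → State n} {φ : HybridArc (State n)} {δ : ℝ}

/-- The time domain alone does not force this: `[0, 1] × {0} ∪ {(0, 1)}` satisfies the truncation
condition. Such branching would need flow out of `D`, which `δ < ω` excludes. -/
theorem IsPerturbedSolution.le_of_lt (hφ : IsPerturbedSolution n ω Q d φ)
    (hd : ∀ t, ‖d t‖ ≤ δ) (hδ : δ < ω) {s t : ℝ} {j k : ℕ} (hjk : j < k) (ht : (t, j) ∈ φ.dom)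
    (hs : (s, k) ∈ φ.dom) : t ≤ s := by
  by_contra! hlt
  have hE := φ.isHybridTimeDomain_dom
  obtain ⟨T, h0, hmono, hS, -, hT⟩ := hE.exists_jump_times hs
  have h1 := (hT (T (j + 1)) j hjk.le).1 ⟨hmono j.le_succ, le_rfl⟩
  have h2 := (hT (T (j + 1)) (j + 1) hjk).1 ⟨le_rfl, hmono (Nat.le_succ _)⟩
  exact hφ.not_mem_D hd hδ ((hS _).trans_lt hlt) (hE.Icc_subset h1.1 ht)
    (hφ.jump _ _ h1.1 h2.1).1

theorem IsPerturbedSolution.exists_isTrace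
    (hQ : ∀ z ∈ Icc 0 (2 * Real.pi), z + Q z ∈ Icc 0 (2 * Real.pi))
    (hφ : IsPerturbedSolution n ω Q d φ) (hd : ∀ t, ‖d t‖ ≤ δ) (hδ0 : 0 ≤ δ) (hδ : δ < ω)
    (hφ0 : φ.val 0 0 ∈ C n) {τ η : ℝ} (hτ : 0 ≤ τ) (hη : 0 < η) :
    ∃ (J : ℕ) (p : ℕ → ℝ × State n × State n), (J : ℝ) ≤ τ ∧ IsTrace ω Q τ J (δ * τ) p ∧
      (∀ j ≤ J, Icc (p j).1 (p (j + 1)).1 ⊆ φ.interval j ∧ (p j).2.1 = φ.val (p j).1 j) ∧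
      ∀ t j, (t, j) ∈ φ.dom → t + j ≤ τ → j ≤ J ∧ (p j).1 ≤ t ∧ t ≤ (p (j + 1)).1 + η := by
  have hE := φ.isHybridTimeDomain_dom
  obtain ⟨S, J, hSJ, hle, hlast⟩ := hE.exists_last hτ hη
  obtain ⟨T, h0, hmono, hS, hTS, hT⟩ := hE.exists_jump_times hSJ
  have hτS : S ≤ τ := by linarith [Nat.cast_nonneg (α := ℝ) J]
  have hint : ∀ j ≤ J, Icc (T j) (T (j + 1)) ⊆ φ.interval j := fun j hj t ht =>
    ((hT t j hj).1 ht).1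
  have hjump : ∀ j < J, φ.val (T (j + 1)) j ∈ D n ∧
      φ.val (T (j + 1)) (j + 1) ∈ G Q (φ.val (T (j + 1)) j) := fun j hj =>
    hφ.jump _ _ (hint j hj.le (right_mem_Icc.2 (hmono j.le_succ)))
      (hint (j + 1) hj (left_mem_Icc.2 (hmono (Nat.le_succ _))))
  have hX : ∀ j ≤ J, φ.val (T j) j ∈ C n := by
    rintro (_ | j) hj
    · rwa [h0]
    · exact G_subset_C hQ (hjump j hj).1 (hjump j hj).2
  have hY : ∀ j ≤ J, φ.val (T (j + 1)) j ∈ C n := by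
    intro j hj
    rcases (hmono j.le_succ).eq_or_lt with heq | hlt
    · exact heq ▸ hX j hj
    · exact hφ.mem_C_of_lt hlt (hint j hj) (right_mem_Icc.2 hlt.le)
  -- Past `J` the states are padded with a point of `C`, since `IsTrace.mem` concerns every index.
  refine ⟨J, fun j => (T j, if j ≤ J then φ.val (T j) j else φ.val 0 0,
    if j ≤ J then φ.val (T (j + 1)) j else φ.val 0 0), by linarith [hE.nonneg hSJ], ?_, ?_, ?_⟩
  · refine ⟨fun j => ⟨⟨h0 ▸ hmono (Nat.zero_le j), (hS j).trans hτS⟩, ?_, ?_⟩, h0, hmono, ?_, ?_⟩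
    · dsimp only
      split_ifs with hj
      exacts [hX j hj, hφ0]
    · dsimp only
      split_ifs with hj
      exacts [hY j hj, hφ0]
    · intro j hj
      simp only [hj, if_true]
      refine (hφ.norm_flow_sub_le hd (hmono j.le_succ) (hint j hj)).trans ?_
      have : 0 ≤ T j := h0 ▸ hmono (Nat.zero_le j)
      exact mul_le_mul_of_nonneg_left (by linarith [hS (j + 1)]) hδ0
    · intro j hj
      simp only [hj.le, Nat.succ_le_of_lt hj, if_true]
      exact hjump j hj
  · intro j hj
    simp only [hj, if_true]
    exact ⟨hint j hj, trivial⟩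
  · intro t j ht htj
    obtain ⟨hj, hjJ⟩ := hlast t j ht htj
    refine ⟨hj, ?_⟩
    dsimp only
    by_cases htS : t ≤ S
    · have := (hT t j hj).2 ⟨ht, hE.nonneg ht, htS⟩
      exact ⟨this.1, by linarith⟩
    · rcases hj.eq_or_lt with rfl | hlt
      · exact ⟨(hS _).trans (not_le.1 htS).le, hTS ▸ hjJ rfl⟩
      · exact absurd (hφ.le_of_lt hd hδ hlt ht hSJ) htS

end Perturbed

/-! ### From exact traces to nominal solutions. -/

theorem isHybridTimeDomain_of_monotone {T : ℕ → ℝ} (h0 : T 0 = 0) (hT : Monotone T) (J : ℕ) :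
    IsHybridTimeDomain {p : ℝ × ℕ | p.2 ≤ J ∧ T p.2 ≤ p.1 ∧ p.1 ≤ T (p.2 + 1)} := by
  refine ⟨⟨(0, 0), Nat.zero_le _, h0.le, h0 ▸ hT zero_le_one⟩, ?_⟩
  rintro ⟨S, K⟩ ⟨hK, hS1, hS2⟩
  dsimp only at hK hS1 hS2
  have hS : 0 ≤ S := (h0 ▸ hT (Nat.zero_le K) : (0 : ℝ) ≤ T K).trans hS1
  refine ⟨K + 1, fun j => min (T j) S, by omega, by simpa [h0] using hS,
    fun j _ => min_le_min_right _ (hT j.le_succ), ?_⟩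
  ext ⟨t, j⟩
  simp only [mem_inter_iff, mem_ofPred_eq, le_min_iff, min_le_iff]
  constructor
  · rintro ⟨⟨hj, h1, h2⟩, h3, h4, h5⟩
    exact ⟨by omega, Or.inl h1, h2, h4⟩
  · rintro ⟨hj, h1, h2, h3⟩
    have hTS : T j ≤ S := (hT (by omega)).trans hS1
    have h4 : T j ≤ t := h1.elim id fun h => hTS.trans h
    exact ⟨⟨by omega, h4, h2⟩, (h0 ▸ hT (Nat.zero_le j) : (0 : ℝ) ≤ T j).trans h4, h3, by omega⟩

section Nominal

variable {n : ℕ} {ω : ℝ} {Q : ℝ → ℝ} {τ : ℝ} {J : ℕ} {q : ℕ → ℝ × State n × State n}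

/-- The nominal arc that flows from the states recorded in a trace. -/
noncomputable def IsTrace.arc {κ : ℝ} (hq : IsTrace ω Q τ J κ q) : HybridArc (State n) where
  dom := {p | p.2 ≤ J ∧ (q p.2).1 ≤ p.1 ∧ p.1 ≤ (q (p.2 + 1)).1}
  val t j := (q j).2.1 + (ω * (t - (q j).1)) • ones n
  isHybridTimeDomain_dom := isHybridTimeDomain_of_monotone hq.zero hq.mono J
  locallyAbsolutelyContinuous j a b _ _ := by
    have hlip : LipschitzWith ‖ContinuousLinearMap.toSpanSingleton ℝ (ω • ones n)‖₊
        fun t : ℝ => (q j).2.1 + (ω * (t - (q j).1)) • ones n := by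
      refine LipschitzWith.of_dist_le_mul fun s t => ?_
      have := (ContinuousLinearMap.toSpanSingleton ℝ (ω • ones n)).lipschitz.dist_le_mul s t
      rw [dist_eq_norm] at this ⊢
      convert this using 2
      simp only [ContinuousLinearMap.toSpanSingleton_apply]
      module
    exact hlip.lipschitzOnWith.absolutelyContinuousOnInterval

theorem IsTrace.isSolution_arc (hω : 0 < ω) (hq : IsTrace ω Q τ J 0 q) :
    (nominal n ω Q).IsSolution hq.arc where
  init := by
    refine Or.inl (subset_closure ?_)
    simpa [IsTrace.arc, hq.zero, nominal] using (hq.mem 0).2.1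
  flow_mem j t ht i := by
    obtain ⟨hj, h1, h2⟩ : j ≤ J ∧ (q j).1 ≤ t ∧ t ≤ (q (j + 1)).1 :=
      interior_subset (s := hq.arc.interval j) ht
    -- Each coordinate increases between two recorded values in `[0, 2π]`, hence stays there.
    have hy := sub_eq_zero.1 (norm_le_zero_iff.1 (hq.flow j hj))
    have hyi := ((hq.mem j).2.2 i).2
    rw [sub_eq_iff_eq_add.1 hy] at hyi
    have hxi := ((hq.mem j).2.1 i).1
    simp only [PiLp.add_apply, PiLp.smul_apply, ones, smul_eq_mul, mul_one] at hyi
    simp only [IsTrace.arc, PiLp.add_apply, PiLp.smul_apply, ones, smul_eq_mul, mul_one]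
    have h3 : 0 ≤ ω * (t - (q j).1) := mul_nonneg hω.le (by linarith)
    have h4 : ω * (t - (q j).1) ≤ ω * ((q (j + 1)).1 - (q j).1) :=
      mul_le_mul_of_nonneg_left (by linarith) hω.le
    exact ⟨by linarith, by linarith⟩
  flow j _ := by
    refine Eventually.of_forall fun t _ => HasDerivAt.hasDerivWithinAt ?_
    have := ((((hasDerivAt_id t).sub_const (q j).1).const_mul ω).smul_const (ones n)).const_add
      (q j).2.1
    simpa [nominal, IsTrace.arc] using this
  jump t j hj hj' := by
    obtain ⟨-, h1, h2⟩ : j ≤ J ∧ (q j).1 ≤ t ∧ t ≤ (q (j + 1)).1 := hj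
    obtain ⟨hjJ, h3, -⟩ : j + 1 ≤ J ∧ (q (j + 1)).1 ≤ t ∧ t ≤ (q (j + 1 + 1)).1 := hj'
    obtain rfl : t = (q (j + 1)).1 := le_antisymm h2 h3
    have hy := sub_eq_zero.1 (norm_le_zero_iff.1 (hq.flow j (by omega)))
    have h4 : hq.arc.val (q (j + 1)).1 j = (q j).2.2 := by
      rw [sub_eq_iff_eq_add'.1 hy]
      rfl
    have h5 : hq.arc.val (q (j + 1)).1 (j + 1) = (q (j + 1)).2.1 := by
      simp [IsTrace.arc]
    rw [h4, h5]
    exact hq.jump j hjJ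

end Nominal

/-! ### Closeness estimates and conclusion. -/

theorem _root_.exists_mem_Icc_abs_sub_le {a b a' b' t r : ℝ} (hab : a ≤ b) (hat : a' ≤ t)
    (htb : t ≤ b') (ha : |a' - a| ≤ r) (hb : |b' - b| ≤ r) : ∃ s ∈ Icc a b, |t - s| ≤ r := by
  rw [abs_le] at ha hb
  have hr : 0 ≤ r := by linarith
  rcases le_total t a with h | h
  · exact ⟨a, left_mem_Icc.2 hab, abs_le.2 ⟨by linarith, by linarith⟩⟩
  rcases le_total t b with h' | h'
  · exact ⟨t, ⟨h, h'⟩, by simpa using hr⟩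
  · exact ⟨b, right_mem_Icc.2 hab, abs_le.2 ⟨by linarith, by linarith⟩⟩

theorem _root_.norm_affine_sub_affine_le {E : Type*} [SeminormedAddCommGroup E] [NormedSpace ℝ E]
    {x x' v z : E} {a a' t t' ω r κ : ℝ} (hω : 0 ≤ ω) (hx : ‖x - x'‖ ≤ r) (ha : |a - a'| ≤ r)
    (ht : |t - t'| ≤ 2 * r) (hz : ‖z - x - (ω * (t - a)) • v‖ ≤ κ) :
    ‖z - (x' + (ω * (t' - a')) • v)‖ ≤ κ + r + ω * (3 * r) * ‖v‖ := by
  have heq : z - (x' + (ω * (t' - a')) • v) =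
      (z - x - (ω * (t - a)) • v) + (x - x') + (ω * ((t - t') - (a - a'))) • v := by module
  have h3 : |(t - t') - (a - a')| ≤ 3 * r := (abs_sub _ _).trans (by linarith)
  rw [heq]
  refine norm_add₃_le.trans (add_le_add (add_le_add hz hx) ?_)
  rw [norm_smul, norm_mul, Real.norm_of_nonneg hω, Real.norm_eq_abs]
  gcongr

end PCO

/-- Measurability of `d` is Lebesgue measurability, i.e. a.e.-measurability with respect to the
Lebesgue measure on `[0, ∞)`; `d` takes values in the closed Euclidean ball of radius `δ`. -/
theorem proposition3 (n : ℕ) (hn : 2 ≤ n) (ω : ℝ) (hω : 0 < ω) (Q : ℝ → ℝ)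
    (hQ_range : ∀ z ∈ Set.Icc 0 (2 * Real.pi), z + Q z ∈ Set.Icc 0 (2 * Real.pi))
    (hQ_cont : ContinuousOn Q (Set.Icc 0 (2 * Real.pi)))
    (ε : ℝ) (hε : 0 < ε) (τ : ℝ) (hτ : 0 ≤ τ) :
    ∃ δ : ℝ, 0 < δ ∧
      ∀ d : ℝ≥0 → PCO.State n,
        AEMeasurable (fun t : ℝ => d t.toNNReal) (MeasureTheory.volume.restrict (Set.Ici 0)) →
        (∀ t, d t ∈ Metric.closedBall 0 δ) →
        ∀ φd : PCO.HybridArc (PCO.State n),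
          PCO.IsPerturbedSolution n ω Q d φd → φd.val 0 0 ∈ PCO.C n →
          ∃ φ : PCO.HybridArc (PCO.State n),
            (PCO.nominal n ω Q).IsSolution φ ∧ φ.val 0 0 ∈ PCO.C n ∧
            PCO.HybridArc.Close τ ε φ φd := by
  -- The state error will be at most `κ + η + 3ωη‖𝟏‖` with `κ < η`, and the time error at most `2η`;
  -- `η * L = ε / 2` dominates both.
  set L := 4 + 3 * ω * ‖PCO.ones n‖ with hL
  have hLpos : 4 ≤ L := by
    have : 0 ≤ 3 * ω * ‖PCO.ones n‖ := by positivity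
    linarith
  set η := ε / (2 * L) with hη_def
  have hη : 0 < η := by positivity
  have hηL : η * L = ε / 2 := by
    rw [hη_def]
    field_simp
  have hη4 : η * 4 ≤ ε / 2 := hηL ▸ mul_le_mul_of_nonneg_left hLpos hη.le
  -- Only finitely many jump counts `J` fit below `τ`, so one `κ` serves them all.
  have hev : ∀ᶠ κ in nhdsWithin (0 : ℝ) (Set.Ioi 0), κ < η ∧ ∀ J ∈ Set.Iic ⌊τ⌋₊,
      ∀ p : ℕ → ℝ × PCO.State n × PCO.State n, PCO.IsTrace ω Q τ J κ p →
        ∃ q, PCO.IsTrace ω Q τ J 0 q ∧ ∀ j ≤ J + 1, dist (p j) (q j) < η :=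
    ((eventually_lt_nhds hη).filter_mono nhdsWithin_le_nhds).and
      ((Filter.eventually_all_finite (Set.finite_Iic _)).2 fun J _ =>
        PCO.eventually_exists_isTrace_dist_lt hQ_cont hη)
  obtain ⟨κ, ⟨hκη, hκ⟩, (hκ0 : 0 < κ)⟩ := (hev.and self_mem_nhdsWithin).exists
  -- The first bound prevents flow out of `D`; the second gives `δ * τ ≤ κ`, even for `τ = 0`.
  refine ⟨min (ω / 2) (κ / (τ + 1)), by positivity, fun d _ hd φd hφd hφd0 => ?_⟩
  set δ := min (ω / 2) (κ / (τ + 1))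
  have hδ0 : 0 < δ := by positivity
  have hδω : δ < ω := (min_le_left _ _).trans_lt (by linarith)
  have hδτ : δ * τ ≤ κ := by
    have h1 : δ * (τ + 1) ≤ κ := (le_div_iff₀ (by positivity)).1 (min_le_right _ _)
    nlinarith
  have hd' : ∀ t, ‖d t‖ ≤ δ := fun t => mem_closedBall_zero_iff.1 (hd t)
  obtain ⟨J, p, hJ, hp, hpφ, hcov⟩ :=
    hφd.exists_isTrace hQ_range hd' hδ0.le hδω hφd0 hτ hη
  obtain ⟨q, hq, hdist⟩ := hκ J (Nat.le_floor hJ) p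
    ⟨hp.mem, hp.zero, hp.mono, fun j hj => (hp.flow j hj).trans hδτ, hp.jump⟩
  have htime : ∀ j ≤ J + 1, |(p j).1 - (q j).1| ≤ η := fun j hj => by
    rw [← Real.dist_eq]
    exact (le_max_left _ _).trans (hdist j hj).le
  have hstate : ∀ j ≤ J, ‖(p j).2.1 - (q j).2.1‖ ≤ η := fun j hj => by
    rw [← dist_eq_norm]
    exact ((le_max_left _ _).trans (le_max_right _ _)).trans (hdist j (by omega)).le
  have hE := φd.isHybridTimeDomain_dom
  -- Here `s` may exceed `(p (j + 1)).1` by up to `η`, so the flow estimate runs from `(p j).1` to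
  -- `s` itself; this overshoot plus the trace distance accounts for `2 * η`.
  have hclose : ∀ s t j, j ≤ J → (p j).1 ≤ s → s ≤ τ → (s, j) ∈ φd.dom → |s - t| ≤ 2 * η →
      dist (φd.val s j) (hq.arc.val t j) < ε := by
    intro s t j hj hps hsτ hs hst
    have hint := hE.Icc_subset ((hpφ j hj).1 (Set.left_mem_Icc.2 (hp.mono j.le_succ))) hs
    have hflow := hφd.norm_flow_sub_le hd' hps hint
    rw [← (hpφ j hj).2] at hflow
    have hps0 : 0 ≤ (p j).1 := (hp.mem j).1.1
    have := norm_affine_sub_affine_le hω.le (hstate j hj) (htime j (by omega)) hst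
      (hflow.trans ((mul_le_mul_of_nonneg_left (by linarith) hδ0.le).trans hδτ))
    rw [dist_eq_norm]
    refine this.trans_lt ?_
    have h1 : κ + η + ω * (3 * η) * ‖PCO.ones n‖ < η * L := by
      rw [hL]
      linarith
    linarith
  refine ⟨hq.arc, hq.isSolution_arc hω, ?_, ?_, ?_⟩
  · simpa [PCO.IsTrace.arc, hq.zero] using (hq.mem 0).2.1
  · rintro t j ⟨hj, h1, h2⟩ -
    obtain ⟨s, hs, hts⟩ := exists_mem_Icc_abs_sub_le (r := η) (hp.mono j.le_succ) h1 h2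
      (by rw [abs_sub_comm]; exact htime j (by omega))
      (by rw [abs_sub_comm]; exact htime (j + 1) (by omega))
    refine ⟨s, (hpφ j hj).1 hs, by linarith, ?_⟩
    rw [dist_comm]
    exact hclose s t j hj hs.1 (hs.2.trans (hp.mem _).1.2) ((hpφ j hj).1 hs)
      (by rw [abs_sub_comm]; linarith)
  · intro t j ht htj
    obtain ⟨hj, h1, h2⟩ := hcov t j ht htj
    have h3 := htime j (by omega)
    have h4 := abs_le.1 (htime (j + 1) (by omega))
    obtain ⟨s, hs, hts⟩ := exists_mem_Icc_abs_sub_le (r := 2 * η) (hq.mono j.le_succ) h1 h2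
      (by linarith) (abs_le.2 ⟨by linarith, by linarith⟩)
    exact ⟨s, ⟨hj, hs⟩, by linarith,
      hclose t s j hj h1 (by linarith [Nat.cast_nonneg (α := ℝ) j]) ht hts⟩
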